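/- Let $d\ge 2$ be an integer, let $r\ge 1$, and let $\phi=[\phi_1,\dots,\phi_r]^T:\mathbb R\to\mathbb C^r$ have components in $L^1(\mathbb R)\cap L^2(\mathbb R)$ (for instance, $\phi$ continuous with compact support). Suppose that $\phi$ is an orthogonal two-direction multiscaling function with dilation factor $d$, that is: (i) there are $r\times r$ matrices $P_k^+,P_k^-$ ($k\in\mathbb Z$) such that $$\phi(x)=\sqrt d\sum_{k\in\mathbb Z}\bigl[P_k^+\phi(dx-k)+P_k^-\phi(k-dx)\bigr],$$ with unconditional convergence in $L^2(\mathbb R)$; (ii) $\phi$ generates a multiresolution approximation of $L^2(\mathbb R)$: if $V_j$ ($j\in\mathbb Z$) denotes the closed linear span in $L^2(\mathbb R)$ of the functions $\phi_i(d^jx-k)$ and $\phi_i(k-d^jx)$ with $1\le i\le r$, $k\in\mathbb Z$, then $V_j\subseteq V_{j+1}$ for all $j$, $\bigcup_j V_j$ is dense in $L^2(\mathbb R)$, $\bigcap_j V_j=\{0\}$, and the functions $\phi_i(x-k)$, $\phi_i(k-x)$ ($1\le i\le r$, $k\in\mathbb Z$) form a Riesz basis of $V_0$; (iii) for all $j,k\in\mathbb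 Z$, $$\int_{\mathbb R}\phi(x-j)\,\phi(x-k)^*\,dx=\delta_{jk}I_r,\qquad \int_{\mathbb R}\phi(x-j)\,\phi(k-x)^*\,dx=O,$$ where $*$ denotes the conjugate transpose. Let $\Phi(x)=\begin{bmatrix}\phi(x)\\ \phi(-x)\end{bmatrix}\in\mathbb C^{2r}$ and let $\mathbf m_0^\pm=\int_{-\infty}^{\infty}\Phi(x)\,dx$ be its zeroth continuous moment. Then $$(\mathbf m_0^\pm)^*\,\mathbf m_0^\pm=1.$$ -/

import Mathlib

open MeasureTheory Filter Topology
open scoped Matrix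

/-- The doubled function `Φ(x) = [φ(x), φ(-x)]ᵀ`, a vector of `2r` functions: the `inl` entries
are those of `φ(x)`, the `inr` entries those of `φ(-x)`. -/
def doubled {r : ℕ} (φ : ℝ → Fin r → ℂ) (x : ℝ) : Fin r ⊕ Fin r → ℂ :=
  Sum.elim (φ x) (φ (-x))

/-- The `j`-th continuous moment `∫ x ^ j F(x) dx` of a vector of functions. -/
noncomputable def continuousMoment {ι : Type*} [Fintype ι] (F : ℝ → ι → ℂ) (j : ℕ) : ι → ℂ :=
  ∫ x : ℝ, ((x : ℂ) ^ j) • F x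

/-- The matrix-valued inner product `⟨F, G⟩ = ∫ F(x) G(x)^* dx`. -/
noncomputable def innerMatrix {r : ℕ} (F G : ℝ → Fin r → ℂ) : Matrix (Fin r) (Fin r) ℂ :=
  Matrix.of fun a b => ∫ x : ℝ, F x a * star (G x b)

/-- The two-direction recursion relation
`φ(x) = √d ∑ₖ [P⁺ₖ φ(dx - k) + P⁻ₖ φ(k - dx)]`, the series converging unconditionally
in `L²(ℝ)` (for compactly supported orthogonal `φ` it has only finitely many nonzero terms). -/
def SatisfiesRecursion {r : ℕ} (d : ℕ) (φ : ℝ → Fin r → ℂ)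
    (Pp Pm : ℤ → Matrix (Fin r) (Fin r) ℂ) : Prop :=
  Tendsto (fun s : Finset ℤ =>
      eLpNorm (fun x : ℝ => φ x - ((Real.sqrt d : ℝ) : ℂ) •
        ∑ k ∈ s, (Pp k *ᵥ φ ((d : ℝ) * x - k) + Pm k *ᵥ φ ((k : ℝ) - (d : ℝ) * x))) 2 volume)
    atTop (𝓝 0)

/-- The space `V_j`: the closed linear span in `L²(ℝ)` of the functions `φ_i(d^j x - k)` and
`φ_i(k - d^j x)`, for `1 ≤ i ≤ r` and `k ∈ ℤ`. -/
noncomputable def scalingSpace {r : ℕ} (d : ℕ) (φ : ℝ → Fin r → ℂ) (j : ℤ) :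
    Submodule ℂ (Lp ℂ 2 (volume : Measure ℝ)) :=
  (Submodule.span ℂ {g : Lp ℂ 2 (volume : Measure ℝ) | ∃ (i : Fin r) (k : ℤ),
    (g =ᵐ[volume] fun x : ℝ => φ ((d : ℝ) ^ j * x - k) i) ∨
    (g =ᵐ[volume] fun x : ℝ => φ ((k : ℝ) - (d : ℝ) ^ j * x) i)}).topologicalClosure

/-- `φ` generates a multiresolution approximation of `L²(ℝ)` with dilation factor `d`. The
spaces `V_j` are by construction closed, `d`-adic dilates of `V_0`, and `V_0` is invariant under
integer translations; the remaining requirements are listed here. -/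
structure GeneratesMRA {r : ℕ} (d : ℕ) (φ : ℝ → Fin r → ℂ) : Prop where
  nested : ∀ j : ℤ, scalingSpace d φ j ≤ scalingSpace d φ (j + 1)
  dense_union : (⨆ j : ℤ, scalingSpace d φ j).topologicalClosure = ⊤
  trivial_inter : (⨅ j : ℤ, scalingSpace d φ j) = ⊥
  /-- The functions `φ_i(x - k)` and `φ_i(k - x)` form a Riesz basis of `V_0`. -/
  stable : ∃ A B : ℝ, 0 < A ∧ 0 < B ∧ ∀ c : ((Fin r ⊕ Fin r) × ℤ) →₀ ℂ,
    A * (∑ p ∈ c.support, ‖c p‖ ^ 2) ≤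
        ∫ x : ℝ, ‖∑ p ∈ c.support, c p * doubled φ (x - p.2) p.1‖ ^ 2 ∧
    ∫ x : ℝ, ‖∑ p ∈ c.support, c p * doubled φ (x - p.2) p.1‖ ^ 2 ≤
        B * (∑ p ∈ c.support, ‖c p‖ ^ 2)

/-- `φ` is a two-direction multiscaling function of multiplicity `r` and dilation factor `d`. -/
structure IsTwoDirectionMultiscaling {r : ℕ} (d : ℕ) (φ : ℝ → Fin r → ℂ) : Prop where
  memLp_two : MemLp φ 2 volume
  recursion : ∃ Pp Pm : ℤ → Matrix (Fin r) (Fin r) ℂ, SatisfiesRecursion d φ Pp Pm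
  generates : GeneratesMRA d φ

/-- Orthogonality of `φ`: `⟨φ(x - j), φ(x - k)⟩ = δ_{jk} I_r` and
`⟨φ(x - j), φ(k - x)⟩ = O` for all integers `j, k`. -/
structure IsTwoDirectionOrthogonal {r : ℕ} (φ : ℝ → Fin r → ℂ) : Prop where
  same : ∀ j k : ℤ, innerMatrix (fun x => φ (x - j)) (fun x => φ (x - k)) =
    if j = k then 1 else 0
  opposite : ∀ j k : ℤ, innerMatrix (fun x => φ (x - j)) (fun x => φ (k - x)) = 0

/-!
Let `P_a` be the orthogonal projection of `L²(ℝ)` onto the closed span of the functions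
`F_p(a x - k)`. When the integer translates of the components `F_p` are orthonormal, Parseval's
identity and the substitution `y = a x - k` give
`‖P_a 1_(0,1]‖² = ∑ₚ a⁻¹ ∑ₖ |∫_(-k,a-k] F_p|²`. Expanding the squares,
the inner sum is the integral of `F_p(x) conj(F_p(y))` weighted by the number of integers `k` for
which `x + k` and `y + k` both lie in `(0, a]`. That number is `a + O(1 + |x - y|)` and at most
`a + 1`, so by dominated convergence the right-hand side tends to `∑ₚ |∫ F_p|²` as `a → ∞`. In a
multiresolution approximation the left-hand side tends to `‖1_(0,1]‖² = 1` along `a = d ^ j`.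
-/

section Parseval

variable {𝕜 E ι : Type*} [RCLike 𝕜] [NormedAddCommGroup E] [InnerProductSpace 𝕜 E]

theorem hasSum_sq_norm_inner_starProjection [CompleteSpace E] {v : ι → E} (hv : Orthonormal 𝕜 v)
    {U : Submodule 𝕜 E} [U.HasOrthogonalProjection]
    (hU : U = (Submodule.span 𝕜 (Set.range v)).topologicalClosure) (x : E) :
    HasSum (fun i => ‖inner 𝕜 (v i) x‖ ^ 2) (‖U.starProjection x‖ ^ 2) := by
  have : CompleteSpace U := hU ▸ Submodule.topologicalClosure.completeSpace _
  have hmem (i : ι) : v i ∈ U :=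
    hU ▸ Submodule.le_topologicalClosure _ (Submodule.subset_span ⟨i, rfl⟩)
  let w : ι → U := fun i => ⟨v i, hmem i⟩
  have hw : Orthonormal 𝕜 w := ⟨fun i => hv.1 i, fun i j hij => hv.2 hij⟩
  have hmap : (Submodule.span 𝕜 (Set.range w)).map U.subtype = Submodule.span 𝕜 (Set.range v) := by
    rw [Submodule.map_span, ← Set.range_comp]
    rfl
  have hdense : ⊤ ≤ (Submodule.span 𝕜 (Set.range w)).topologicalClosure := by
    intro y _
    rw [← SetLike.mem_coe, Submodule.topologicalClosure_coe,
      Topology.IsInducing.subtypeVal.closure_eq_preimage_closure_image, Set.mem_preimage]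
    have hy : (y : E) ∈ (Submodule.span 𝕜 (Set.range v)).topologicalClosure := hU ▸ y.2
    rwa [← hmap] at hy
  let b := HilbertBasis.mk hw hdense
  have hinner (i : ι) : inner 𝕜 (b i) (U.orthogonalProjectionOnto x) = inner 𝕜 (v i) x := by
    rw [HilbertBasis.coe_mk]
    exact Submodule.inner_orthogonalProjectionOnto_eq_of_mem_left (w i) x
  have hsum := b.hasSum_inner_mul_inner (U.orthogonalProjectionOnto x)
    (U.orthogonalProjectionOnto x)
  rw [inner_self_eq_norm_sq_to_K] at hsum
  refine (RCLike.hasSum_ofReal (𝕜 := 𝕜)).1 ?_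
  convert! hsum using 1
  · funext i
    rw [← hinner, ← inner_conj_symm _ (b i), RCLike.conj_mul]
    norm_cast
  · exact RCLike.ofReal_pow _ _

end Parseval

section Windows

/-- The half-open interval `(0, T]` shifted by `-k`. -/
abbrev window (T : ℝ) (k : ℤ) : Set ℝ := Set.Ioc (-k : ℝ) (T - k)

/-- The integers `k` for which both `x + k` and `y + k` lie in `(0, T]`. -/
noncomputable def commonShifts (T x y : ℝ) : Finset ℤ :=
  Finset.Ioc ⌊-min x y⌋ ⌊T - max x y⌋

theorem mem_commonShifts {T x y : ℝ} {k : ℤ} :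
    k ∈ commonShifts T x y ↔ (x, y) ∈ window T k ×ˢ window T k := by
  rw [commonShifts, Finset.mem_Ioc, Int.floor_lt, Int.le_floor, neg_lt, lt_min_iff, le_sub_comm,
    max_le_iff, Set.mem_prod, Set.mem_Ioc, Set.mem_Ioc]
  exact and_and_and_comm

theorem cast_card_commonShifts_le {T : ℝ} (hT : 0 ≤ T) (x y : ℝ) :
    ((commonShifts T x y).card : ℝ) ≤ T + 1 := by
  rw [commonShifts, Int.card_Ioc]
  rcases le_total (⌊T - max x y⌋ - ⌊-min x y⌋) 0 with h | h
  · rw [Int.toNat_of_nonpos h, Nat.cast_zero]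
    positivity
  · rw [← Int.cast_natCast, Int.toNat_of_nonneg h, Int.cast_sub]
    linarith [Int.floor_le (T - max x y), Int.lt_floor_add_one (-min x y),
      min_le_max (a := x) (b := y)]

theorem le_cast_card_commonShifts (T x y : ℝ) :
    T - |x - y| - 1 ≤ (commonShifts T x y).card := by
  have hcard : ((⌊T - max x y⌋ - ⌊-min x y⌋ : ℤ) : ℝ) ≤ (commonShifts T x y).card := by
    rw [commonShifts, Int.card_Ioc]
    exact_mod_cast Int.self_le_toNat _
  push_cast at hcard
  rw [← max_sub_min_eq_abs']
  linarith [Int.floor_le (-min x y), Int.lt_floor_add_one (T - max x y)]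

theorem tendsto_card_commonShifts_div (x y : ℝ) :
    Tendsto (fun T : ℝ => ((commonShifts T x y).card : ℝ) / T) atTop (𝓝 1) := by
  have hconst (c : ℝ) : Tendsto (fun T : ℝ => (T + c) / T) atTop (𝓝 1) := by
    have hlim := (tendsto_const_nhds (x := (1 : ℝ))).add
      ((tendsto_const_nhds (x := c)).div_atTop (tendsto_id (x := (atTop : Filter ℝ))))
    rw [add_zero] at hlim
    refine hlim.congr' ?_
    filter_upwards [eventually_gt_atTop 0] with T hT
    rw [id_eq, add_div, div_self hT.ne']
  refine tendsto_of_tendsto_of_tendsto_of_le_of_le' (hconst (-(|x - y| + 1))) (hconst 1) ?_ ?_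
  · filter_upwards [eventually_gt_atTop 0] with T hT
    gcongr
    linarith [le_cast_card_commonShifts T x y]
  · filter_upwards [eventually_gt_atTop 0] with T hT
    gcongr
    exact cast_card_commonShifts_le hT.le x y

theorem measurable_card_commonShifts (T : ℝ) :
    Measurable fun z : ℝ × ℝ => ((commonShifts T z.1 z.2).card : ℝ) := by
  have hcard : Measurable fun p : ℤ × ℤ => ((Finset.Ioc p.1 p.2).card : ℝ) :=
    measurable_of_countable _
  have hends : Measurable fun z : ℝ × ℝ => (⌊-min z.1 z.2⌋, ⌊T - max z.1 z.2⌋) :=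
    (measurable_fst.min measurable_snd).neg.floor.prodMk
      ((measurable_fst.max measurable_snd).const_sub T).floor
  simpa only [Function.comp_def, commonShifts] using hcard.comp hends

theorem integrable_card_commonShifts_smul {G : Type*} [NormedAddCommGroup G] [NormedSpace ℝ G]
    {T : ℝ} (hT : 0 ≤ T) {f : ℝ × ℝ → G} (hf : Integrable f) :
    Integrable fun z => ((commonShifts T z.1 z.2).card : ℝ) • f z :=
  hf.bdd_smul (T + 1) (measurable_card_commonShifts T).aestronglyMeasurable <|
    Eventually.of_forall fun z => by
      simpa only [Real.norm_natCast] using cast_card_commonShifts_le hT z.1 z.2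

theorem hasSum_indicator_window {G : Type*} [NormedAddCommGroup G] [NormedSpace ℝ G]
    (T : ℝ) (f : ℝ × ℝ → G) (z : ℝ × ℝ) :
    HasSum (fun k : ℤ => (window T k ×ˢ window T k).indicator f z)
      (((commonShifts T z.1 z.2).card : ℝ) • f z) := by
  rw [Nat.cast_smul_eq_nsmul, ← Finset.sum_const, ← Finset.sum_congr rfl fun k hk =>
    Set.indicator_of_mem (mem_commonShifts.1 hk) f]
  exact hasSum_sum_of_ne_finset_zero fun k hk =>
    Set.indicator_of_notMem (fun hz => hk (mem_commonShifts.2 hz)) f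

theorem hasSum_setIntegral_window {G : Type*} [NormedAddCommGroup G] [NormedSpace ℝ G]
    {T : ℝ} (hT : 0 ≤ T) {f : ℝ × ℝ → G} (hf : Integrable f) :
    HasSum (fun k : ℤ => ∫ z in window T k ×ˢ window T k, f z)
      (∫ z, ((commonShifts T z.1 z.2).card : ℝ) • f z) := by
  have hmeas (k : ℤ) : MeasurableSet (window T k ×ˢ window T k) :=
    measurableSet_Ioc.prod measurableSet_Ioc
  have hnorm (z : ℝ × ℝ) := hasSum_indicator_window T (fun z => ‖f z‖) z
  simp_rw [← integral_indicator (hmeas _)]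
  refine hasSum_integral_of_dominated_convergence
    (fun k => (window T k ×ˢ window T k).indicator fun z => ‖f z‖)
    (fun k => hf.aestronglyMeasurable.indicator (hmeas k))
    (fun k => Eventually.of_forall fun z => (norm_indicator_eq_indicator_norm f z).le)
    (Eventually.of_forall fun z => (hnorm z).summable) ?_
    (Eventually.of_forall (hasSum_indicator_window T f))
  simp_rw [(hnorm _).tsum_eq]
  exact integrable_card_commonShifts_smul hT hf.norm

theorem tendsto_inv_mul_integral_card_commonShifts {G : Type*} [NormedAddCommGroup G]
    [NormedSpace ℝ G] {f : ℝ × ℝ → G} (hf : Integrable f) :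
    Tendsto (fun T : ℝ => T⁻¹ • ∫ z, ((commonShifts T z.1 z.2).card : ℝ) • f z) atTop
      (𝓝 (∫ z, f z)) := by
  simp_rw [← integral_smul, smul_smul, inv_mul_eq_div]
  refine tendsto_integral_filter_of_dominated_convergence (fun z => 2 * ‖f z‖) ?_ ?_
    (hf.norm.const_mul 2) (Eventually.of_forall fun z => ?_)
  · exact Eventually.of_forall fun T =>
      ((measurable_card_commonShifts T).div_const T).aestronglyMeasurable.smul
        hf.aestronglyMeasurable
  · filter_upwards [eventually_ge_atTop 1] with T hT
    refine Eventually.of_forall fun z => ?_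
    have hcard : ((commonShifts T z.1 z.2).card : ℝ) ≤ 2 * T := by
      linarith [cast_card_commonShifts_le (zero_le_one.trans hT) z.1 z.2]
    rw [norm_smul, Real.norm_of_nonneg (by positivity)]
    gcongr
    exact div_le_of_le_mul₀ (by positivity) zero_le_two hcard
  · simpa only [one_smul] using (tendsto_card_commonShifts_div z.1 z.2).smul_const (f z)

variable {H : Type*} [NormedAddCommGroup H] [InnerProductSpace ℝ H]

theorem integrable_inner_prod {α : Type*} [MeasurableSpace α] {μ : Measure α} {f : α → H}
    (hf : Integrable f μ) :
    Integrable (fun z : α × α => inner ℝ (f z.1) (f z.2)) (μ.prod μ) :=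
  hf.op_fst_snd continuous_inner ⟨1, fun x y => by simpa using norm_inner_le_norm (𝕜 := ℝ) x y⟩ hf

theorem integral_inner_prod [CompleteSpace H] {α : Type*} [MeasurableSpace α] {μ : Measure α}
    [SFinite μ] {f : α → H} (hf : Integrable f μ) :
    ∫ z, inner ℝ (f z.1) (f z.2) ∂μ.prod μ = ‖∫ x, f x ∂μ‖ ^ 2 :=
  (integral_prod_bilin (innerSL ℝ) hf hf).trans (real_inner_self_eq_norm_sq _)

theorem tendsto_inv_mul_tsum_sq_norm_window [CompleteSpace H] {f : ℝ → H} (hf : Integrable f) :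
    Tendsto (fun T : ℝ => T⁻¹ * ∑' k : ℤ, ‖∫ x in window T k, f x‖ ^ 2) atTop
      (𝓝 (‖∫ x, f x‖ ^ 2)) := by
  have hlim := tendsto_inv_mul_integral_card_commonShifts (integrable_inner_prod hf)
  rw [Measure.volume_eq_prod, integral_inner_prod hf] at hlim
  refine hlim.congr' ?_
  filter_upwards [eventually_ge_atTop 0] with T hT
  rw [← Measure.volume_eq_prod, ← (hasSum_setIntegral_window hT (integrable_inner_prod hf)).tsum_eq,
    smul_eq_mul]
  congr! with k
  rw [Measure.volume_eq_prod, ← Measure.prod_restrict, integral_inner_prod hf.integrableOn]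

end Windows

section DilatedTranslates

variable {ι : Type*}

/-- The integer translates of the components of `F` form an orthonormal system in `L²(ℝ)`. -/
def HasOrthonormalTranslates [DecidableEq ι] (F : ℝ → ι → ℂ) : Prop :=
  ∀ (p q : ι) (j k : ℤ), ∫ x : ℝ, F (x - j) p * star (F (x - k) q) =
    if (p, j) = (q, k) then 1 else 0

/-- The closed linear span in `L²(ℝ)` of the functions `F_p(a x - k)`; for `a = d ^ j` and
`F = doubled φ` this is the space `V_j` of the multiresolution approximation. -/
noncomputable def dilateSpace (F : ℝ → ι → ℂ) (a : ℝ) :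
    Submodule ℂ (Lp ℂ 2 (volume : Measure ℝ)) :=
  (Submodule.span ℂ {g : Lp ℂ 2 (volume : Measure ℝ) | ∃ (p : ι) (k : ℤ),
    g =ᵐ[volume] fun x : ℝ => F (a * x - k) p}).topologicalClosure

instance (F : ℝ → ι → ℂ) (a : ℝ) : CompleteSpace (dilateSpace F a) :=
  Submodule.topologicalClosure.completeSpace _

/-- The indicator function of `(0, 1]` as an element of `L²(ℝ)`. -/
noncomputable def unitIndicator : Lp ℂ 2 (volume : Measure ℝ) :=
  indicatorConstLp 2 (measurableSet_Ioc (a := (0 : ℝ)) (b := 1)) (by simp) 1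

theorem norm_unitIndicator : ‖unitIndicator‖ = 1 := by
  rw [unitIndicator, norm_indicatorConstLp (by simp) (by simp)]
  simp

theorem memLp_comp_mul_sub {E : Type*} [NormedAddCommGroup E] {f : ℝ → E} {q : ENNReal}
    (hf : MemLp f q) {a : ℝ} (ha : a ≠ 0) (b : ℝ) : MemLp (fun x => f (a * x - b)) q := by
  refine MemLp.comp_of_map (f := fun x => a * x) (g := fun x => f (x - b)) ?_ (by fun_prop)
  rw [Real.map_volume_mul_left ha]
  exact (hf.comp_measurePreserving (measurePreserving_sub_right volume b)).smul_measure
    ENNReal.ofReal_ne_top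

variable [Fintype ι] {F : ℝ → ι → ℂ} {a : ℝ}

/-- The function `√a F_p(a x - k)` as an element of `L²(ℝ)`; the factor `√a` makes the dilation
unitary. -/
noncomputable def dilatedTranslate (hF : MemLp F 2) (ha : 0 < a) (q : ι × ℤ) :
    Lp ℂ 2 (volume : Measure ℝ) :=
  ((√a : ℝ) : ℂ) • (memLp_comp_mul_sub (hF.eval q.1) ha.ne' q.2).toLp

theorem coeFn_dilatedTranslate (hF : MemLp F 2) (ha : 0 < a) (p : ι) (k : ℤ) :
    dilatedTranslate hF ha (p, k) =ᵐ[volume] fun x => ((√a : ℝ) : ℂ) * F (a * x - k) p := by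
  filter_upwards [Lp.coeFn_smul ((√a : ℝ) : ℂ) (memLp_comp_mul_sub (hF.eval p) ha.ne' k).toLp,
    (memLp_comp_mul_sub (hF.eval p) ha.ne' k).coeFn_toLp] with x hsmul htoLp
  rw [dilatedTranslate, hsmul, Pi.smul_apply, htoLp, smul_eq_mul]

theorem dilateSpace_eq_closure_span_dilatedTranslate (hF : MemLp F 2) (ha : 0 < a) :
    dilateSpace F a =
      (Submodule.span ℂ (Set.range (dilatedTranslate hF ha))).topologicalClosure := by
  have hunit : IsUnit ((√a : ℝ) : ℂ) := by
    simpa only [isUnit_iff_ne_zero, ne_eq, Complex.ofReal_eq_zero] using (Real.sqrt_pos.2 ha).ne'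
  have hgen : {g : Lp ℂ 2 (volume : Measure ℝ) | ∃ (p : ι) (k : ℤ),
      g =ᵐ[volume] fun x : ℝ => F (a * x - k) p} =
      Set.range fun q : ι × ℤ => (memLp_comp_mul_sub (hF.eval q.1) ha.ne' q.2).toLp := by
    ext g
    simp only [Set.mem_ofPred_eq, Set.mem_range, Prod.exists]
    refine exists₂_congr fun p k => ?_
    have htoLp := (memLp_comp_mul_sub (hF.eval p) ha.ne' k).coeFn_toLp
    exact ⟨fun hg => Lp.ext (htoLp.trans hg.symm), fun hg => hg ▸ htoLp⟩
  rw [dilateSpace, hgen, ← Submodule.span_smul_eq_of_isUnit _ _ hunit, Set.smul_set_range]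
  rfl

theorem orthonormal_dilatedTranslate [DecidableEq ι] (hF : MemLp F 2) (ha : 0 < a)
    (horth : HasOrthonormalTranslates F) :
    Orthonormal ℂ (dilatedTranslate hF ha) := by
  rw [orthonormal_iff_ite]
  rintro ⟨p, j⟩ ⟨q, k⟩
  have hsqrt : ((√a : ℝ) : ℂ) * ((√a : ℝ) : ℂ) = (a : ℂ) := by
    rw [← Complex.ofReal_mul, Real.mul_self_sqrt ha.le]
  calc inner ℂ (dilatedTranslate hF ha (p, j)) (dilatedTranslate hF ha (q, k))
      = ∫ x, (a : ℂ) * (F (a * x - k) q * star (F (a * x - j) p)) := by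
        rw [L2.inner_def]
        refine integral_congr_ae ?_
        filter_upwards [coeFn_dilatedTranslate hF ha p j, coeFn_dilatedTranslate hF ha q k]
          with x hp hq
        rw [hp, hq, RCLike.inner_apply, map_mul, Complex.conj_ofReal, ← hsqrt, starRingEnd_apply]
        ring
    _ = ∫ x, F (x - k) q * star (F (x - j) p) := by
        rw [integral_const_mul,
          Measure.integral_comp_mul_left (fun y => F (y - k) q * star (F (y - j) p)),
          abs_of_pos (inv_pos.2 ha), Complex.real_smul, ← mul_assoc, ← Complex.ofReal_mul,
          mul_inv_cancel₀ ha.ne', Complex.ofReal_one, one_mul]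
    _ = if (p, j) = (q, k) then 1 else 0 := by
        rw [horth]
        exact if_congr eq_comm rfl rfl

theorem sq_norm_inner_dilatedTranslate_unitIndicator (hF : MemLp F 2) (ha : 0 < a) (p : ι)
    (k : ℤ) :
    ‖inner ℂ (dilatedTranslate hF ha (p, k)) unitIndicator‖ ^ 2 =
      a⁻¹ * ‖∫ x in window a k, F x p‖ ^ 2 := by
  have hinner : inner ℂ unitIndicator (dilatedTranslate hF ha (p, k)) =
      ((√a : ℝ) : ℂ) * (a⁻¹ • ∫ x in window a k, F x p) := by
    rw [unitIndicator, L2.inner_indicatorConstLp_one, setIntegral_congr_ae measurableSet_Ioc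
      ((coeFn_dilatedTranslate hF ha p k).mono fun x hx _ => hx), integral_const_mul,
      ← intervalIntegral.integral_of_le zero_le_one,
      intervalIntegral.integral_comp_mul_sub (fun x => F x p) ha.ne', mul_zero, zero_sub, mul_one,
      intervalIntegral.integral_of_le (by linarith)]
  rw [norm_inner_symm, hinner, norm_mul, norm_smul, mul_pow, mul_pow, Complex.norm_real,
    Real.norm_of_nonneg (Real.sqrt_nonneg a), Real.sq_sqrt ha.le,
    Real.norm_of_nonneg (inv_nonneg.2 ha.le)]
  field_simp

theorem sq_norm_starProjection_unitIndicator [DecidableEq ι] (hF : MemLp F 2) (ha : 0 < a)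
    (horth : HasOrthonormalTranslates F) :
    ‖(dilateSpace F a).starProjection unitIndicator‖ ^ 2 =
      ∑ p, a⁻¹ * ∑' k : ℤ, ‖∫ x in window a k, F x p‖ ^ 2 := by
  have hsum := hasSum_sq_norm_inner_starProjection (orthonormal_dilatedTranslate hF ha horth)
    (dilateSpace_eq_closure_span_dilatedTranslate hF ha) unitIndicator
  rw [← hsum.tsum_eq, hsum.summable.tsum_prod, tsum_fintype]
  simp only [sq_norm_inner_dilatedTranslate_unitIndicator, tsum_mul_left]

theorem tendsto_sq_norm_starProjection_unitIndicator [DecidableEq ι] (hint : Integrable F)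
    (hF : MemLp F 2) (horth : HasOrthonormalTranslates F) :
    Tendsto (fun a : ℝ => ‖(dilateSpace F a).starProjection unitIndicator‖ ^ 2) atTop
      (𝓝 (∑ p, ‖∫ x, F x p‖ ^ 2)) := by
  refine (tendsto_finsetSum Finset.univ fun p _ =>
    tendsto_inv_mul_tsum_sq_norm_window (hint.eval p)).congr' ?_
  filter_upwards [eventually_gt_atTop 0] with a ha
  exact (sq_norm_starProjection_unitIndicator hF ha horth).symm

theorem star_continuousMoment_zero_dotProduct (hint : Integrable F) :
    star (continuousMoment F 0) ⬝ᵥ continuousMoment F 0 =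
      ((∑ p, ‖∫ x, F x p‖ ^ 2 : ℝ) : ℂ) := by
  rw [dotProduct, Complex.ofReal_sum]
  refine Finset.sum_congr rfl fun p _ => ?_
  have hmoment : continuousMoment F 0 p = ∫ x, F x p := by
    simp only [continuousMoment, pow_zero, one_smul]
    exact eval_integral hint.eval p
  rw [Pi.star_apply, hmoment, Complex.ofReal_pow]
  exact Complex.conj_mul' _

theorem theorem3p4_general [DecidableEq ι] (ha : 1 < a) (hint : Integrable F)
    (hF : MemLp F 2) (horth : HasOrthonormalTranslates F)
    (hmono : Monotone fun j : ℤ => dilateSpace F (a ^ j))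
    (hdense : (⨆ j : ℤ, dilateSpace F (a ^ j)).topologicalClosure = ⊤) :
    star (continuousMoment F 0) ⬝ᵥ continuousMoment F 0 = 1 := by
  have hscale : Tendsto (fun n : ℕ => a ^ (n : ℤ)) atTop atTop := by
    simpa only [zpow_natCast] using tendsto_pow_atTop_atTop_of_one_lt ha
  have hmoment := (tendsto_sq_norm_starProjection_unitIndicator hint hF horth).comp hscale
  have hone : Tendsto
      (fun n : ℕ => ‖(dilateSpace F (a ^ (n : ℤ))).starProjection unitIndicator‖ ^ 2)
      atTop (𝓝 1) := by
    simpa only [norm_unitIndicator, one_pow, Function.comp_def] using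
      ((Submodule.starProjection_tendsto_self _ hmono unitIndicator hdense.ge).comp
        tendsto_natCast_atTop_atTop).norm.pow 2
  rw [star_continuousMoment_zero_dotProduct hint, tendsto_nhds_unique hmoment hone,
    Complex.ofReal_one]

end DilatedTranslates

section Doubled

variable {r : ℕ} {φ : ℝ → Fin r → ℂ}

theorem memLp_doubled {q : ENNReal} (hφ : MemLp φ q) : MemLp (doubled φ) q :=
  MemLp.of_eval fun
    | .inl i => hφ.eval i
    | .inr i => (hφ.eval i).comp_measurePreserving (Measure.measurePreserving_neg volume)

theorem integrable_doubled (hφ : Integrable φ) : Integrable (doubled φ) :=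
  memLp_one_iff_integrable.1 (memLp_doubled (memLp_one_iff_integrable.2 hφ))

theorem scalingSpace_eq_dilateSpace_doubled (d : ℕ) (φ : ℝ → Fin r → ℂ) :
    scalingSpace d φ = fun j : ℤ => dilateSpace (doubled φ) ((d : ℝ) ^ j) := by
  funext j
  simp only [scalingSpace, dilateSpace, doubled, Sum.exists, Sum.elim_inl, Sum.elim_inr, neg_sub,
    exists_or]

theorem IsTwoDirectionOrthogonal.hasOrthonormalTranslates_doubled
    (hφ : IsTwoDirectionOrthogonal φ) : HasOrthonormalTranslates (doubled φ) := by
  have hsame (a b : Fin r) (j k : ℤ) : ∫ x : ℝ, φ (x - j) a * star (φ (x - k) b) =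
      if (a, j) = (b, k) then 1 else 0 := by
    refine (congrFun₂ (hφ.same j k) a b).trans ?_
    split_ifs <;> simp_all [Matrix.one_apply]
  have hopp (a b : Fin r) (j k : ℤ) : ∫ x : ℝ, φ (x - j) a * star (φ (k - x) b) = 0 :=
    congrFun₂ (hφ.opposite j k) a b
  rintro (a | a) (b | b) j k
  · simpa [doubled] using hsame a b j k
  · simpa [doubled] using hopp a b j k
  · have hconj : ∫ x : ℝ, star (φ (x - k) b * star (φ (j - x) a)) = 0 :=
      integral_conj.trans (by rw [hopp, map_zero])
    simpa [doubled, mul_comm] using hconj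
  · have hneg := hsame a b (-j) (-k)
    rw [← integral_neg_eq_self] at hneg
    simpa [doubled, neg_add_eq_sub] using hneg

end Doubled

theorem theorem3p4 (r d : ℕ) (hd : 2 ≤ d) (φ : ℝ → Fin r → ℂ)
    (hint : Integrable φ volume)
    (hφ : IsTwoDirectionMultiscaling d φ)
    (horth : IsTwoDirectionOrthogonal φ) :
    star (continuousMoment (doubled φ) 0) ⬝ᵥ continuousMoment (doubled φ) 0 = 1 := by
  have hV := scalingSpace_eq_dilateSpace_doubled d φ
  exact theorem3p4_general (by exact_mod_cast hd) (integrable_doubled hint)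
    (memLp_doubled hφ.memLp_two) horth.hasOrthonormalTranslates_doubled
    (hV ▸ monotone_int_of_le_succ hφ.generates.nested) (hV ▸ hφ.generates.dense_union)
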